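/- Let $\mathbb{A}_{\mathbb{Q}}$ be the ring of adeles of $\mathbb{Q}$ (the product of $\mathbb{R}$ with the restricted product of the fields $\mathbb{Q}_p$ with respect to the subrings $\mathbb{Z}_p$), and let $\psi:\mathbb{A}_{\mathbb{Q}}\to\mathbb{C}$ be its standard additive character $$\psi(x)=\prod_{v\le\infty}\psi_v(x(v)),\qquad \psi_\infty(t)=e^{-2\pi i t}\ (t\in\mathbb{R}),\qquad \psi_p(t)=e^{2\pi i\{t\}}\ (t\in\mathbb{Q}_p),$$ where the $p$-adic fractional part of $t=\sum_{j\ge -N}c_jp^j$ (with digits $0\le c_j<p$) is $\{t\}=\sum_{-N\le j\le -1}c_jp^j$. Then the first-order theory of $(\mathbb{A}_{\mathbb{Q}},\psi)$ is undecidable: there is no algorithm that decides, given (the Gödel number of) a first-order sentence, whether it is true in the structure. This holds both (1) for the two-sorted structure that consists of the ring $\mathbb{A}_{\mathbb{Q}}$, the field $\mathbb{C}$ and the function $\psi$ from the first sort to the second, and (2) for the ring $\mathbb{A}_{\mathbb{Q}}$, in the language of rings expanded by one unary predicate, interpreted as $\{x\in\mathbb{A}_{\mathbb{Q}} : \psi(x)=1\}$.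 -/

import Mathlib

noncomputable section

open FirstOrder NumberField

namespace AdelicCharacter

/-! ### The standard additive character of the rational adeles -/

instance factPrime (p : Nat.Primes) : Fact p.1.Prime := ⟨p.2⟩

/-- Multiplying `x ∈ ℚ_p` by `p ^ n`, where `n = max (-v_p(x)) 0`, gives a `p`-adic integer. -/
theorem norm_pow_mul_le_one {p : ℕ} [Fact p.Prime] (x : ℚ_[p]) :
    ‖(p : ℚ_[p]) ^ (-x.valuation).toNat * x‖ ≤ 1 := by
  rcases eq_or_ne x 0 with rfl | hx
  · simp
  have hp : (1 : ℝ) < p := by exact_mod_cast (Fact.out : p.Prime).one_lt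
  rw [norm_mul, norm_pow, Padic.norm_p, Padic.norm_eq_zpow_neg_valuation hx, ← zpow_natCast,
    inv_zpow', ← zpow_add₀ (by positivity)]
  exact zpow_le_one_of_nonpos₀ hp.le (by omega)

/-- The `p`-adic integer `p ^ n * x`, where `n = max (-v_p(x)) 0`. -/
def padicScale {p : ℕ} [Fact p.Prime] (x : ℚ_[p]) : ℤ_[p] :=
  ⟨(p : ℚ_[p]) ^ (-x.valuation).toNat * x, norm_pow_mul_le_one x⟩

/-- The `p`-adic fractional part `{x} = ∑_{j < 0} c_j p ^ j` of
`x = ∑_j c_j p ^ j ∈ ℚ_p` with digits `0 ≤ c_j < p`. Here `PadicInt.appr y n` is the truncation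
`∑_{j < n} c_j p ^ j` of the digit expansion of a `p`-adic integer `y`. -/
def padicFract {p : ℕ} [Fact p.Prime] (x : ℚ_[p]) : ℚ :=
  ((padicScale x).appr (-x.valuation).toNat : ℚ) / (p : ℚ) ^ (-x.valuation).toNat

/-- The additive character `ψ_p(x) = exp(2πi {x})` of `ℚ_p`. -/
def padicChar {p : ℕ} [Fact p.Prime] (x : ℚ_[p]) : ℂ :=
  Complex.exp (2 * Real.pi * Complex.I * (padicFract x : ℂ))

/-- The additive character `ψ_∞(x) = exp(-2πi x)` of `ℝ`. -/
def realChar (x : ℝ) : ℂ :=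
  Complex.exp (-(2 * Real.pi * Complex.I * (x : ℂ)))

/-- The ring of adeles of `ℚ`. -/
abbrev RatAdele : Type := AdeleRing (𝓞 ℚ) ℚ

/-- The real component of a rational adele. -/
def realComponent (x : RatAdele) : ℝ :=
  InfinitePlace.Completion.extensionEmbeddingOfIsReal Rat.isReal_infinitePlace
    (x.1 Rat.infinitePlace)

/-- The component in `ℚ_p` of a rational adele, where `p` is the prime number generating the
place `v`. -/
def padicComponent (x : RatAdele) (v : IsDedekindDomain.HeightOneSpectrum (𝓞 ℚ)) :
    ℚ_[Rat.HeightOneSpectrum.primesEquiv v] :=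
  Rat.HeightOneSpectrum.adicCompletion.padicEquiv v (x.2 v)

/-- The standard additive character `ψ(x) = ∏_{v ≤ ∞} ψ_v(x(v))` of the rational adeles. All but
finitely many factors are `1` (see `finite_mulSupport_padicChar`). -/
def ratAdeleChar (x : RatAdele) : ℂ :=
  realChar (realComponent x) * ∏ᶠ v : IsDedekindDomain.HeightOneSpectrum (𝓞 ℚ), padicChar (padicComponent x v)

theorem padicChar_eq_one {p : ℕ} [Fact p.Prime] {x : ℚ_[p]} (hx : ‖x‖ ≤ 1) :
    padicChar x = 1 := by
  have h : (-x.valuation).toNat = 0 := by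
    have := Padic.norm_le_one_iff_val_nonneg x |>.1 hx
    omega
  have h0 : padicFract x = 0 := by
    have h1 := (padicScale x).appr_lt (-x.valuation).toNat
    rw [h, pow_zero, Nat.lt_one_iff] at h1
    rw [padicFract, h, h1]
    simp
  simp [padicChar, h0]

theorem finite_mulSupport_padicChar (x : RatAdele) :
    (Function.mulSupport fun v => padicChar (padicComponent x v)).Finite := by
  have h := x.2.2
  rw [Filter.eventually_cofinite] at h
  refine h.subset fun v hv hint => hv (padicChar_eq_one (x := padicComponent x v) ?_)
  exact (Rat.HeightOneSpectrum.adicCompletion.padicEquiv_bijOn v).mapsTo hint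

/-! ### The adeles with the character as first-order structures -/

/-- The relation symbols of the language of rings with a predicate for a character: one unary
symbol. -/
inductive CharRel : ℕ → Type
  | char : CharRel 1

/-- The language of rings `(+, *, -, 0, 1)` expanded by one unary predicate symbol. -/
def ringWithPredicate : FirstOrder.Language where
  Functions := ringFunc
  Relations := CharRel

/-- The ring of rational adeles in which the unary predicate holds of `x` if and only if
`ψ(x) = 1`. -/
instance ratAdeleStructure : ringWithPredicate.Structure RatAdele where
  funMap {n} (f : ringFunc n) v := match n, f, v with
    | _, .add, v => v 0 + v 1
    | _, .mul, v => v 0 * v 1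
    | _, .neg, v => -v 0
    | _, .zero, _ => 0
    | _, .one, _ => 1
  RelMap {n} (r : CharRel n) v := match n, r, v with
    | _, .char, v => ratAdeleChar (v 0) = 1

/-- The relation symbols of the two-sorted language of a ring, a field and a map from the ring to
the field: two sorts, the graphs of addition and multiplication on each, the graph of the map. -/
inductive TwoSortedRel : ℕ → Type
  | isRing : TwoSortedRel 1
  | isField : TwoSortedRel 1
  | addRing : TwoSortedRel 3
  | mulRing : TwoSortedRel 3
  | addField : TwoSortedRel 3
  | mulField : TwoSortedRel 3
  | char : TwoSortedRel 2

/-- The (relational) two-sorted language of a ring, a field and a map from the ring to the field.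
The sorts are unary predicates. -/
def twoSorted : FirstOrder.Language where
  Functions := fun _ => Empty
  Relations := TwoSortedRel

/-- The two-sorted structure that consists of the ring of rational adeles, the field of complex
numbers and the function `ψ` from the first to the second. -/
instance ratAdeleTwoSorted : twoSorted.Structure (RatAdele ⊕ ℂ) where
  funMap {_} (f : Empty) _ := f.elim
  RelMap {n} (r : TwoSortedRel n) v := match n, r, v with
    | _, .isRing, v => ∃ a : RatAdele, v 0 = .inl a
    | _, .isField, v => ∃ z : ℂ, v 0 = .inr z
    | _, .addRing, v => ∃ a b : RatAdele, v 0 = .inl a ∧ v 1 = .inl b ∧ v 2 = .inl (a + b)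
    | _, .mulRing, v => ∃ a b : RatAdele, v 0 = .inl a ∧ v 1 = .inl b ∧ v 2 = .inl (a * b)
    | _, .addField, v => ∃ z w : ℂ, v 0 = .inr z ∧ v 1 = .inr w ∧ v 2 = .inr (z + w)
    | _, .mulField, v => ∃ z w : ℂ, v 0 = .inr z ∧ v 1 = .inr w ∧ v 2 = .inr (z * w)
    | _, .char, v => ∃ a : RatAdele, v 0 = .inl a ∧ v 1 = .inr (ratAdeleChar a)

/-! ### Decidability of a first-order theory -/

/-- Gödel number of a sentence: the standard code of the list of symbols that spells the sentence,
for a given numbering of the function and the relation symbols. -/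
def godelNumber {L : FirstOrder.Language.{0, 0}} [Encodable (Σ n, L.Functions n)]
    [Encodable (Σ n, L.Relations n)] (φ : L.Sentence) : ℕ :=
  Encodable.encode (FirstOrder.Language.BoundedFormula.listEncode φ)

theorem godelNumber_injective {L : FirstOrder.Language.{0, 0}} [Encodable (Σ n, L.Functions n)]
    [Encodable (Σ n, L.Relations n)] : Function.Injective (godelNumber (L := L)) := by
  intro φ χ h
  have := FirstOrder.Language.BoundedFormula.listEncode_sigma_injective (L := L) (α := Empty)
    (a₁ := ⟨0, φ⟩) (a₂ := ⟨0, χ⟩) (Encodable.encode_injective h)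
  simpa using this

/-- The complete first-order theory of the structure `M`, in a language with finitely many
numbered symbols, is decidable: some algorithm tells whether a given number is the Gödel number of
a sentence that is true in `M`. -/
def DecidableTheory (L : FirstOrder.Language.{0, 0}) [Encodable (Σ n, L.Functions n)]
    [Encodable (Σ n, L.Relations n)] (M : Type) [L.Structure M] : Prop :=
  ComputablePred fun k : ℕ => ∃ φ : L.Sentence, φ ∈ L.completeTheory M ∧ godelNumber φ = k

instance encodableRingWithPredicateFunctions : Encodable (Σ n, ringWithPredicate.Functions n) :=
  Encodable.ofInj (β := ℕ)
    (fun f : Σ n, ringFunc n => match f with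
      | ⟨_, .add⟩ => 0
      | ⟨_, .mul⟩ => 1
      | ⟨_, .neg⟩ => 2
      | ⟨_, .zero⟩ => 3
      | ⟨_, .one⟩ => 4)
    (by rintro ⟨_, f⟩ ⟨_, g⟩ h; cases f <;> cases g <;> simp_all)

instance encodableRingWithPredicateRelations : Encodable (Σ n, ringWithPredicate.Relations n) :=
  Encodable.ofInj (β := ℕ)
    (fun r : Σ n, CharRel n => match r with
      | ⟨_, .char⟩ => 0)
    (by rintro ⟨_, f⟩ ⟨_, g⟩ _; cases f; cases g; rfl)

instance encodableTwoSortedFunctions : Encodable (Σ n, twoSorted.Functions n) :=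
  Encodable.ofInj (β := ℕ) (fun f : Σ _ : ℕ, Empty => f.2.elim) (by rintro ⟨_, f⟩; exact f.elim)

instance encodableTwoSortedRelations : Encodable (Σ n, twoSorted.Relations n) :=
  Encodable.ofInj (β := ℕ)
    (fun r : Σ n, TwoSortedRel n => match r with
      | ⟨_, .isRing⟩ => 0
      | ⟨_, .isField⟩ => 1
      | ⟨_, .addRing⟩ => 2
      | ⟨_, .mulRing⟩ => 3
      | ⟨_, .addField⟩ => 4
      | ⟨_, .mulField⟩ => 5
      | ⟨_, .char⟩ => 6)
    (by rintro ⟨_, f⟩ ⟨_, g⟩ h; cases f <;> cases g <;> simp_all)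

end AdelicCharacter

end

/-!
Both structures interpret the semiring `ℕ`, and the theory of a structure that interprets `ℕ` is
undecidable.

*The natural numbers are definable.* An adele `x` is a rational integer if and only if
`x * y ∈ ker ψ` for all `y ∈ ker ψ` (`exists_int_iff_forall_ratAdeleChar`). Conceptually, `ψ` maps
the adeles onto the unit circle, so that for such an `x` the character `y ↦ ψ (x * y)` is `ψ`
followed by an endomorphism `t ↦ t ^ n` of the circle, whence `x = n`. The proof is elementary.
The adele `y` that is `1` at the real place and `0` elsewhere shows that the real component of `x`
is an integer `n`. For a prime `p`, the adele that is `1 / p ^ k` at the real place and at `p`, and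
`0` elsewhere, lies in `ker ψ`; it shows that `(x_p - n) / p ^ k` is a `p`-adic integer. This holds
for all `k`, whence `x_p = n`. By Lagrange's four squares theorem, the set of natural numbers is
definable too (`AdeleInterp.arithInterp`). In the two-sorted structure, `ker ψ` is definable since
`1 ∈ ℂ` is.

*Structures that interpret arithmetic are undecidable.* Gödel's β-function makes primitive
recursion definable, so that the graph of each partial recursive function is interpretable
(`ArithInterp.graph_partrec`), and in particular the halting set `H` is. There are sentences `S n`
that say `n ∉ H`, in which the numeral `n` is written as a chain of `n` atomic formulas
`x_{k+2} + 1 = x_{k+3}` (`numeralNe`). The list of symbols of `S n`, and hence its Gödel number, is a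
primitive recursive function of `n`, so that an algorithm that decides the theory would solve the
halting problem (`ArithInterp.not_decidableTheory`).
-/

open FirstOrder NumberField

namespace AdelicCharacter

/-! ### The integers inside the adeles -/

section

/-- The fractional part `{x}` differs from `x` by a `p`-adic integer. -/
theorem norm_padicFract_sub_le_one {p : ℕ} [Fact p.Prime] (x : ℚ_[p]) :
    ‖x - (padicFract x : ℚ_[p])‖ ≤ 1 := by
  set n := (-x.valuation).toNat with hn
  have hp : (0 : ℝ) < p := by exact_mod_cast (Fact.out : p.Prime).pos
  have hp' : (p : ℚ_[p]) ≠ 0 := by exact_mod_cast (Fact.out : p.Prime).ne_zero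
  have h := (PadicInt.norm_le_pow_iff_mem_span_pow _ n).2 (PadicInt.appr_spec n (padicScale x))
  have h' : ((padicScale x - ((padicScale x).appr n : ℤ_[p]) : ℤ_[p]) : ℚ_[p]) =
      (p : ℚ_[p]) ^ n * (x - (padicFract x : ℚ_[p])) := by
    simp only [PadicInt.coe_sub, PadicInt.coe_natCast, padicFract, ← hn]
    push_cast
    rw [mul_sub, mul_div_cancel₀ _ (pow_ne_zero _ hp')]
    rfl
  rw [PadicInt.norm_def, h', norm_mul, norm_pow, Padic.norm_p, zpow_neg, zpow_natCast, inv_pow] at h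
  have : (0 : ℝ) < ((p : ℝ) ^ n)⁻¹ := by positivity
  exact le_of_mul_le_mul_left (by simpa using h) this

/-- A rational number of the form `a / p ^ k` that is a `p`-adic integer is an integer. -/
theorem exists_int_eq_of_norm_le_one {p : ℕ} [Fact p.Prime] (a : ℤ) (k : ℕ)
    (h : ‖(a : ℚ_[p]) / (p : ℚ_[p]) ^ k‖ ≤ 1) : ∃ m : ℤ, (a : ℂ) / (p : ℂ) ^ k = m := by
  have hp : (0 : ℝ) < p := by exact_mod_cast (Fact.out : p.Prime).pos
  have hp' : (p : ℂ) ≠ 0 := by exact_mod_cast (Fact.out : p.Prime).ne_zero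
  rw [norm_div, norm_pow, Padic.norm_p, div_le_one (by positivity), inv_pow, ← zpow_natCast,
    ← zpow_neg, Padic.norm_int_le_pow_iff_dvd] at h
  obtain ⟨m, rfl⟩ := h
  exact ⟨m, by push_cast; field_simp⟩

theorem cexp_eq_cexp_of_sub_eq_int {z w : ℂ} (m : ℤ) (h : z - w = m) :
    Complex.exp (2 * Real.pi * Complex.I * z) = Complex.exp (2 * Real.pi * Complex.I * w) := by
  rw [Complex.exp_eq_exp_iff_exists_int]
  exact ⟨m, by linear_combination (2 * Real.pi * Complex.I) * h⟩

/-- The character `ψ_p` may be computed from any approximation of its argument, modulo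
`ℤ_p`, by a rational number with denominator a power of `p`. -/
theorem padicChar_eq_cexp {p : ℕ} [Fact p.Prime] {x : ℚ_[p]} (a : ℤ) (k : ℕ)
    (h : ‖x - (a : ℚ_[p]) / (p : ℚ_[p]) ^ k‖ ≤ 1) :
    padicChar x = Complex.exp (2 * Real.pi * Complex.I * ((a : ℂ) / (p : ℂ) ^ k)) := by
  have hp' : (p : ℂ) ≠ 0 := by exact_mod_cast (Fact.out : p.Prime).ne_zero
  have hp'' : (p : ℚ_[p]) ≠ 0 := by exact_mod_cast (Fact.out : p.Prime).ne_zero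
  set n := (-x.valuation).toNat with hn
  set b := (padicScale x).appr n with hb
  have hf : padicFract x = (b : ℚ) / (p : ℚ) ^ n := rfl
  have h1 := norm_padicFract_sub_le_one x
  have h2 : ‖(((b * p ^ k - a * p ^ n : ℤ) : ℚ_[p])) / (p : ℚ_[p]) ^ (n + k)‖ ≤ 1 := by
    have : (((b * p ^ k - a * p ^ n : ℤ) : ℚ_[p])) / (p : ℚ_[p]) ^ (n + k) =
        (x - (a : ℚ_[p]) / (p : ℚ_[p]) ^ k) - (x - (padicFract x : ℚ_[p])) := by
      rw [hf]
      push_cast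
      field_simp
      ring
    rw [this, sub_eq_add_neg]
    exact (Padic.nonarchimedean _ _).trans (max_le h (by rwa [norm_neg]))
  obtain ⟨m, hm⟩ := exists_int_eq_of_norm_le_one _ _ h2
  refine cexp_eq_cexp_of_sub_eq_int m ?_
  rw [← hm, hf]
  push_cast
  field_simp
  ring

theorem padicChar_add {p : ℕ} [Fact p.Prime] (x y : ℚ_[p]) :
    padicChar (x + y) = padicChar x * padicChar y := by
  have hp' : (p : ℂ) ≠ 0 := by exact_mod_cast (Fact.out : p.Prime).ne_zero
  have hp'' : (p : ℚ_[p]) ≠ 0 := by exact_mod_cast (Fact.out : p.Prime).ne_zero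
  set n := (-x.valuation).toNat with hn
  set b := (padicScale x).appr n with hb
  have hx : padicFract x = (b : ℚ) / (p : ℚ) ^ n := rfl
  set m := (-y.valuation).toNat with hm
  set c := (padicScale y).appr m with hc
  have hy : padicFract y = (c : ℚ) / (p : ℚ) ^ m := rfl
  rw [padicChar_eq_cexp (x := x + y) (b * p ^ m + c * p ^ n) (n + m), padicChar, padicChar,
    ← Complex.exp_add]
  · congr 1
    rw [hx, hy]
    push_cast
    field_simp
    ring
  · have : x + y - ((b * p ^ m + c * p ^ n : ℤ) : ℚ_[p]) / (p : ℚ_[p]) ^ (n + m) =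
        (x - (padicFract x : ℚ_[p])) + (y - (padicFract y : ℚ_[p])) := by
      rw [hx, hy]
      push_cast
      field_simp
      ring
    rw [this]
    exact (Padic.nonarchimedean _ _).trans
      (max_le (norm_padicFract_sub_le_one x) (norm_padicFract_sub_le_one y))

theorem cexp_eq_one_iff (z : ℂ) :
    Complex.exp (2 * Real.pi * Complex.I * z) = 1 ↔ ∃ m : ℤ, z = m := by
  rw [Complex.exp_eq_one_iff]
  refine exists_congr fun m => ?_
  rw [mul_comm (m : ℂ), mul_right_inj' Complex.two_pi_I_ne_zero]

theorem padicChar_eq_one_iff {p : ℕ} [Fact p.Prime] {x : ℚ_[p]} : padicChar x = 1 ↔ ‖x‖ ≤ 1 := by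
  refine ⟨fun h => ?_, padicChar_eq_one⟩
  obtain ⟨m, hm⟩ := (cexp_eq_one_iff _).1 h
  have hm' : padicFract x = m := by exact_mod_cast hm
  have h1 := norm_padicFract_sub_le_one x
  rw [hm'] at h1
  have h2 : ‖((m : ℚ) : ℚ_[p])‖ ≤ 1 := by simpa using Padic.norm_int_le_one m
  simpa using (Padic.nonarchimedean _ _).trans (max_le h1 h2)

theorem realChar_add (x y : ℝ) : realChar (x + y) = realChar x * realChar y := by
  rw [realChar, realChar, realChar, ← Complex.exp_add]
  congr 1
  push_cast
  ring

theorem realChar_eq_one_iff {x : ℝ} : realChar x = 1 ↔ ∃ m : ℤ, x = m := by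
  rw [realChar, ← mul_neg, cexp_eq_one_iff]
  constructor
  · rintro ⟨m, hm⟩
    exact ⟨-m, by rw [neg_eq_iff_eq_neg] at hm; exact_mod_cast hm⟩
  · rintro ⟨m, rfl⟩
    exact ⟨-m, by simp⟩

theorem realComponent_add (x y : RatAdele) :
    realComponent (x + y) = realComponent x + realComponent y :=
  map_add (InfinitePlace.Completion.extensionEmbeddingOfIsReal Rat.isReal_infinitePlace) _ _

theorem realComponent_mul (x y : RatAdele) :
    realComponent (x * y) = realComponent x * realComponent y :=
  map_mul (InfinitePlace.Completion.extensionEmbeddingOfIsReal Rat.isReal_infinitePlace) _ _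

theorem padicComponent_add (x y : RatAdele) (v) :
    padicComponent (x + y) v = padicComponent x v + padicComponent y v :=
  map_add (Rat.HeightOneSpectrum.adicCompletion.padicEquiv v) _ _

theorem padicComponent_mul (x y : RatAdele) (v) :
    padicComponent (x * y) v = padicComponent x v * padicComponent y v :=
  map_mul (Rat.HeightOneSpectrum.adicCompletion.padicEquiv v) _ _

theorem padicComponent_intCast (n : ℤ) (v) : padicComponent (n : RatAdele) v = n :=
  map_intCast (Rat.HeightOneSpectrum.adicCompletion.padicEquiv v) n

theorem realComponent_intCast (n : ℤ) : realComponent (n : RatAdele) = n :=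
  map_intCast (InfinitePlace.Completion.extensionEmbeddingOfIsReal Rat.isReal_infinitePlace) n

theorem ratAdeleChar_add (x y : RatAdele) :
    ratAdeleChar (x + y) = ratAdeleChar x * ratAdeleChar y := by
  simp only [ratAdeleChar, realComponent_add, realChar_add, padicComponent_add, padicChar_add]
  rw [finprod_mul_distrib (finite_mulSupport_padicChar x) (finite_mulSupport_padicChar y)]
  ring

/-- An adele is determined by its real and its `p`-adic components. -/
theorem ratAdele_ext {x y : RatAdele} (hr : realComponent x = realComponent y)
    (hp : ∀ v, padicComponent x v = padicComponent y v) : x = y := by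
  refine Prod.ext (funext fun w => ?_) ?_
  · obtain rfl : w = Rat.infinitePlace := Subsingleton.elim _ _
    exact RingHom.injective _ hr
  · ext v
    exact congrArg _ ((Rat.HeightOneSpectrum.adicCompletion.padicEquiv v).injective (hp v))

/-- There are adeles with a given rational real component and a given `v`-component that vanish at
all other places. -/
theorem exists_adele (q : ℚ) (v : IsDedekindDomain.HeightOneSpectrum (𝓞 ℚ))
    (a : ℚ_[Rat.HeightOneSpectrum.primesEquiv v]) :
    ∃ y : RatAdele, realComponent y = q ∧ padicComponent y v = a ∧
      ∀ w, w ≠ v → padicComponent y w = 0 := by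
  classical
  let f : IsDedekindDomain.FiniteAdeleRing (𝓞 ℚ) ℚ := RestrictedProduct.single
    (fun w : IsDedekindDomain.HeightOneSpectrum (𝓞 ℚ) => w.adicCompletionIntegers ℚ) v
      ((Rat.HeightOneSpectrum.adicCompletion.padicEquiv v).symm a)
  have hf : f v = (Rat.HeightOneSpectrum.adicCompletion.padicEquiv v).symm a :=
    RestrictedProduct.single_eq_same _ _ _
  have hf' : ∀ w, w ≠ v → f w = 0 := fun w hw => RestrictedProduct.single_eq_of_ne _ _ hw
  refine ⟨(fun _ => (q : InfinitePlace.Completion _), f), ?_, ?_, fun w hw => ?_⟩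
  · exact map_ratCast (InfinitePlace.Completion.extensionEmbeddingOfIsReal
      Rat.isReal_infinitePlace) q
  · simp [padicComponent, hf]
  · simp [padicComponent, hf' w hw]

theorem ratAdeleChar_of_single {y : RatAdele} {v : IsDedekindDomain.HeightOneSpectrum (𝓞 ℚ)}
    (h : ∀ w, w ≠ v → padicComponent y w = 0) :
    ratAdeleChar y = realChar (realComponent y) * padicChar (padicComponent y v) := by
  rw [ratAdeleChar, finprod_eq_single _ v fun w hw => ?_]
  rw [h w hw]
  exact padicChar_eq_one (by simp)

theorem ratAdeleChar_int_mul (n : ℤ) {y : RatAdele} (hy : ratAdeleChar y = 1) :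
    ratAdeleChar (n * y) = 1 := by
  let χ : AddChar RatAdele ℂ :=
    { toFun := ratAdeleChar
      map_zero_eq_one' := by
        have h0 : ∀ v, padicComponent 0 v = 0 := fun v => by
          simpa using padicComponent_intCast 0 v
        have h1 : realComponent 0 = 0 := by simpa using realComponent_intCast 0
        rw [ratAdeleChar, h1, finprod_eq_one_of_forall_eq_one fun v => ?_]
        · simp [realChar]
        · exact padicChar_eq_one (by rw [h0]; simp)
      map_add_eq_mul' := ratAdeleChar_add }
  have h : χ (n • y) = χ y ^ n := AddChar.map_zsmul_eq_zpow χ n y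
  have h' : χ y = 1 := hy
  rw [h', one_zpow, zsmul_eq_mul] at h
  exact h

/-- The rational integers are exactly the adeles that multiply the kernel of `ψ` into itself. -/
theorem exists_int_iff_forall_ratAdeleChar (x : RatAdele) :
    (∃ n : ℤ, x = n) ↔ ∀ y, ratAdeleChar y = 1 → ratAdeleChar (x * y) = 1 := by
  refine ⟨?_, fun h => ?_⟩
  · rintro ⟨n, rfl⟩ y hy
    exact ratAdeleChar_int_mul n hy
  -- The hypothesis for the adele that is `q` at the real place, `a` at `v` and `0` elsewhere.
  have key : ∀ (q : ℚ) (v : IsDedekindDomain.HeightOneSpectrum (𝓞 ℚ))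
      (a : ℚ_[Rat.HeightOneSpectrum.primesEquiv v]), realChar q * padicChar a = 1 →
      realChar (realComponent x * q) * padicChar (padicComponent x v * a) = 1 := by
    intro q v a hqa
    obtain ⟨y, h1, h2, h3⟩ := exists_adele q v a
    have := h y (by rw [ratAdeleChar_of_single h3, h1, h2, hqa])
    rwa [ratAdeleChar_of_single (v := v) fun w hw => by rw [padicComponent_mul, h3 w hw, mul_zero],
      realComponent_mul, padicComponent_mul, h1, h2] at this
  obtain ⟨n, hn⟩ : ∃ n : ℤ, realComponent x = n := by
    have v : IsDedekindDomain.HeightOneSpectrum (𝓞 ℚ) :=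
      Rat.HeightOneSpectrum.primesEquiv.symm ⟨2, Nat.prime_two⟩
    have := key 1 v 0 (by
      rw [padicChar_eq_one (by simp), mul_one, realChar_eq_one_iff]
      exact ⟨1, by simp⟩)
    rw [mul_zero, padicChar_eq_one (by simp), mul_one, realChar_eq_one_iff] at this
    simpa using this
  refine ⟨n, ratAdele_ext (by rw [hn, realComponent_intCast]) fun v => ?_⟩
  rw [padicComponent_intCast]
  set p := Rat.HeightOneSpectrum.primesEquiv v with hp
  have hpp := (factPrime p).out
  have hp0 : (p.1 : ℚ_[p]) ≠ 0 := by exact_mod_cast hpp.ne_zero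
  have hpC : (p.1 : ℂ) ≠ 0 := by exact_mod_cast hpp.ne_zero
  -- `ψ_∞` and `ψ_p` are inverse to each other on `ℤ[1 / p]`.
  have hinv : ∀ (a : ℤ) (k : ℕ), realChar (((a : ℚ) / (p.1 : ℚ) ^ k : ℚ) : ℝ) *
      padicChar ((a : ℚ_[p]) / (p.1 : ℚ_[p]) ^ k) = 1 := by
    intro a k
    rw [padicChar_eq_cexp a k (by simp), realChar, ← Complex.exp_add]
    push_cast
    rw [neg_add_cancel, Complex.exp_zero]
  -- Hence the difference of `x_p` and `n` is divisible by every power of `p`.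
  have hdiv : ∀ k : ℕ, ‖(padicComponent x v - n) / (p.1 : ℚ_[p]) ^ k‖ ≤ 1 := by
    intro k
    rw [← padicChar_eq_one_iff]
    have h1 := key _ v _ (hinv 1 k)
    have h2 := hinv n k
    have h3 : padicComponent x v * (((1 : ℤ) : ℚ_[p]) / (p.1 : ℚ_[p]) ^ k) =
        (padicComponent x v - n) / (p.1 : ℚ_[p]) ^ k + (n : ℚ_[p]) / (p.1 : ℚ_[p]) ^ k := by
      push_cast
      ring
    have h4 : realComponent x * ((((1 : ℤ) : ℚ) / (p.1 : ℚ) ^ k : ℚ) : ℝ) =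
        (((n : ℚ) / (p.1 : ℚ) ^ k : ℚ) : ℝ) := by
      rw [hn]
      push_cast
      ring
    rw [h3, h4, padicChar_add, mul_left_comm, h2, mul_one] at h1
    exact h1
  by_contra hne
  have hpos : 0 < ‖padicComponent x v - n‖ := norm_pos_iff.2 (sub_ne_zero.2 hne)
  obtain ⟨k, hk⟩ := exists_pow_lt_of_lt_one hpos
    (inv_lt_one_of_one_lt₀ (by exact_mod_cast hpp.one_lt : (1 : ℝ) < p.1))
  have := hdiv k
  rw [norm_div, norm_pow, Padic.norm_p, div_le_one (by have := hpp.pos; positivity)] at this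
  exact absurd this (not_le.2 hk)

end

/-! ### Relations interpretable in a structure -/

section

open FirstOrder.Language

variable (L : FirstOrder.Language.{0, 0}) {M N : Type} [L.Structure M]

/-- A relation on `N` is interpretable by means of the coding `f : N → M` of the elements of `N`
if its image is a subset of a power of `M` that is definable without parameters. -/
def Interp (f : N → M) {α : Type} (P : (α → N) → Prop) : Prop :=
  (∅ : Set M).Definable L ((fun v => f ∘ v) '' {v : α → N | P v})

/-- A coding of the elements of `N` by elements of a structure `M`, such that the set of codes is
definable without parameters. -/
structure Coding (f : N → M) : Prop where
  inj : Function.Injective f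
  univ : Interp L f fun _ : Fin 1 → N => True

/-- A coding of the natural numbers for which addition and multiplication are definable. -/
structure ArithInterp (f : ℕ → M) : Prop extends Coding L f where
  add : Interp L f fun v : Fin 3 → ℕ => v 0 + v 1 = v 2
  mul : Interp L f fun v : Fin 3 → ℕ => v 0 * v 1 = v 2

variable {L} {f : N → M} {α β : Type}

theorem Interp.of_iff {P Q : (α → N) → Prop} (h : Interp L f P) (hPQ : ∀ v, Q v ↔ P v) :
    Interp L f Q := by
  rwa [show Q = P from funext fun v => propext (hPQ v)]

/-- Interpretability is kept by existential quantification: the variables of the scope are those of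
the context, `some i`, and the bound variable `none`. -/
theorem Interp.ex [Finite α] {P : (α → N) → N → Prop}
    (hP : Interp L f fun v : Option α → N => P (fun i => v (some i)) (v none)) :
    Interp L f fun v => ∃ n, P v n := by
  have := Set.Definable.image_comp hP (some : α → Option α)
  rw [Interp]
  convert! this using 1
  ext w
  simp only [Set.mem_image, Set.mem_ofPred_eq, exists_exists_and_eq_and]
  constructor
  · rintro ⟨v, ⟨n, hn⟩, rfl⟩
    exact ⟨fun o => o.elim n v, hn, rfl⟩
  · rintro ⟨v, hv, rfl⟩
    exact ⟨fun i => v (some i), ⟨_, hv⟩, rfl⟩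

namespace Coding

variable (hf : Coding L f)
include hf

theorem image_injective : Function.Injective fun v : α → N => f ∘ v :=
  hf.inj.comp_left

/-- The tuples of codes form a definable set. -/
theorem definable_range [Finite α] :
    (∅ : Set M).Definable L {w : α → M | ∀ i, w i ∈ Set.range f} := by
  have : {w : α → M | ∀ i, w i ∈ Set.range f} = ⋂ i : α, {w | w i ∈ Set.range f} := by
    ext; simp
  rw [this]
  refine Set.definable_iInter_of_finite fun i => ?_
  have h := hf.univ.preimage_comp (fun _ : Fin 1 => i)
  convert h using 1
  ext w
  simp only [Set.mem_ofPred_eq, Set.mem_range, Set.preimage, Set.mem_image, true_and]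
  constructor
  · rintro ⟨n, hn⟩
    exact ⟨fun _ => n, funext fun _ => hn⟩
  · rintro ⟨v, hv⟩
    exact ⟨v 0, congrFun hv 0⟩

theorem and {P Q : (α → N) → Prop} (hP : Interp L f P) (hQ : Interp L f Q) :
    Interp L f fun v => P v ∧ Q v := by
  have := Set.Definable.inter hP hQ
  rwa [← Set.image_inter hf.image_injective] at this

theorem not [Finite α] {P : (α → N) → Prop} (hP : Interp L f P) :
    Interp L f fun v => ¬ P v := by
  have := hf.definable_range.sdiff hP
  rw [Interp]
  convert! this using 1
  ext w
  simp only [Set.mem_image, Set.mem_ofPred_eq, Set.mem_sdiff]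
  constructor
  · rintro ⟨v, hv, rfl⟩
    exact ⟨fun i => ⟨v i, rfl⟩, fun ⟨u, hu, huv⟩ => hv (hf.image_injective huv ▸ hu)⟩
  · rintro ⟨h1, h2⟩
    choose v hv using h1
    obtain rfl : f ∘ v = w := funext hv
    exact ⟨v, fun h => h2 ⟨v, h, rfl⟩, rfl⟩

theorem or [Finite α] {P Q : (α → N) → Prop} (hP : Interp L f P) (hQ : Interp L f Q) :
    Interp L f fun v => P v ∨ Q v :=
  (hf.not (hf.and (hf.not hP) (hf.not hQ))).of_iff fun v => by tauto

theorem imp [Finite α] {P Q : (α → N) → Prop} (hP : Interp L f P) (hQ : Interp L f Q) :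
    Interp L f fun v => P v → Q v :=
  (hf.or (hf.not hP) hQ).of_iff fun v => by tauto

/-- Interpretability is kept when variables are renamed, identified or added. -/
theorem reindex [Finite β] {P : (α → N) → Prop} (hP : Interp L f P) (g : α → β) :
    Interp L f fun v : β → N => P fun i => v (g i) := by
  have := hf.definable_range.inter (hP.preimage_comp g)
  rw [Interp]
  convert! this using 1
  ext w
  simp only [Set.mem_image, Set.mem_ofPred_eq, Set.mem_inter_iff, Set.mem_preimage]
  constructor
  · rintro ⟨v, hv, rfl⟩
    exact ⟨fun i => ⟨v i, rfl⟩, _, hv, rfl⟩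
  · rintro ⟨h1, u, hu, huv⟩
    choose v hv using h1
    obtain rfl : f ∘ v = w := funext hv
    obtain rfl := hf.image_injective (a₁ := u) (a₂ := v ∘ g) huv
    exact ⟨v, hu, rfl⟩

theorem all [Finite α] {P : (α → N) → N → Prop}
    (hP : Interp L f fun v : Option α → N => P (fun i => v (some i)) (v none)) :
    Interp L f fun v => ∀ n, P v n :=
  (hf.not (Interp.ex (P := fun v n => ¬ P v n) (hf.not hP))).of_iff fun v => by simp

end Coding

section Arithmetic

variable {f : ℕ → M}

variable (L f) in
/-- A function on tuples of natural numbers whose graph is interpretable. -/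
def InterpFun (g : (α → ℕ) → ℕ) : Prop :=
  Interp L f fun v : Option α → ℕ => v none = g fun i => v (some i)

namespace ArithInterp

variable (hf : ArithInterp L f)
include hf

/-- Substitution of a function with interpretable graph for a variable. -/
theorem subst [Finite α] {P : (α → ℕ) → ℕ → Prop} {g : (α → ℕ) → ℕ}
    (hP : Interp L f fun v : Option α → ℕ => P (fun i => v (some i)) (v none))
    (hg : InterpFun L f g) : Interp L f fun v => P v (g v) :=
  (Interp.ex (P := fun v n => n = g v ∧ P v n) (hf.and hg hP)).of_iff fun v => by simp

/-- Substitution of functions with interpretable graphs into a binary relation. -/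
theorem subst₂ [Finite α] {R : ℕ → ℕ → Prop} {g h : (α → ℕ) → ℕ}
    (hR : Interp L f fun v : Fin 2 → ℕ => R (v 0) (v 1))
    (hg : InterpFun L f g) (hh : InterpFun L f h) : Interp L f fun v => R (g v) (h v) := by
  refine hf.subst (P := fun v m => R m (h v)) ?_ hg
  refine hf.subst (P := fun v m => R (v none) m) ?_ (hf.reindex hh (Option.map some))
  exact hf.reindex hR ![some none, none]

/-- Substitution of functions with interpretable graphs into a ternary relation. -/
theorem subst₃ [Finite α] {R : ℕ → ℕ → ℕ → Prop} {g h k : (α → ℕ) → ℕ}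
    (hR : Interp L f fun v : Fin 3 → ℕ => R (v 0) (v 1) (v 2))
    (hg : InterpFun L f g) (hh : InterpFun L f h) (hk : InterpFun L f k) :
    Interp L f fun v => R (g v) (h v) (k v) := by
  refine hf.subst (P := fun v m => R m (h v) (k v)) ?_ hg
  refine hf.subst (P := fun v m => R (v none) m (k fun i => v (some i))) ?_
    (hf.reindex hh (Option.map some))
  refine hf.subst (P := fun v m => R (v (some none)) (v none) m) ?_
    (hf.reindex hk (Option.map (some ∘ some)))
  exact hf.reindex hR ![some (some none), some none, none]

theorem eq_var [Finite α] (i j : α) : Interp L f fun v : α → ℕ => v i = v j := by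
  have : Interp L f fun v : Fin 2 → ℕ => v 0 = v 1 := by
    -- `a = b` holds if and only if `a + 0 = b`, and `0` is the only `n` with `n + n = n`.
    have h := Interp.ex (α := Fin 2) (P := fun v n => n + n = n ∧ v 0 + n = v 1)
      (hf.and (hf.reindex hf.add ![none, none, none])
        (hf.reindex hf.add ![some 0, none, some 1]))
    refine h.of_iff fun v => ⟨fun h => ⟨0, by simpa using h⟩, ?_⟩
    rintro ⟨n, h1, h2⟩
    omega
  exact hf.reindex this ![i, j]

theorem var [Finite α] (i : α) : InterpFun L f fun v => v i :=
  hf.eq_var none (some i)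

theorem eq [Finite α] {g h : (α → ℕ) → ℕ} (hg : InterpFun L f g) (hh : InterpFun L f h) :
    Interp L f fun v => g v = h v :=
  hf.subst₂ (hf.eq_var 0 1) hg hh

/-- Weakening of the context by one variable. -/
theorem lift [Finite α] {g : (α → ℕ) → ℕ} (hg : InterpFun L f g) :
    InterpFun L f fun v : Option α → ℕ => g fun i => v (some i) :=
  hf.reindex hg (Option.map some)

theorem add_fun [Finite α] {g h : (α → ℕ) → ℕ} (hg : InterpFun L f g) (hh : InterpFun L f h) :
    InterpFun L f fun v => g v + h v :=
  (hf.subst₃ (R := fun a b c => a + b = c) hf.add (hf.lift hg) (hf.lift hh)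
    (hf.var none)).of_iff fun _ => eq_comm

theorem mul_fun [Finite α] {g h : (α → ℕ) → ℕ} (hg : InterpFun L f g) (hh : InterpFun L f h) :
    InterpFun L f fun v => g v * h v :=
  (hf.subst₃ (R := fun a b c => a * b = c) hf.mul (hf.lift hg) (hf.lift hh)
    (hf.var none)).of_iff fun _ => eq_comm

theorem zero [Finite α] : InterpFun L f fun _ : α → ℕ => 0 :=
  (hf.reindex hf.add ![none, none, none]).of_iff fun v => by simp

theorem one [Finite α] : InterpFun L f fun _ : α → ℕ => 1 := by
  have h := hf.and (hf.eq (hf.mul_fun (hf.var (none : Option α)) (hf.var none)) (hf.var none))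
    (hf.not (hf.eq (hf.var (none : Option α)) hf.zero))
  refine h.of_iff fun v => ⟨fun h => by simp [h], fun ⟨h1, h2⟩ => ?_⟩
  exact Nat.eq_of_mul_eq_mul_left (Nat.pos_of_ne_zero h2) (by simpa using h1)

theorem lt [Finite α] {g h : (α → ℕ) → ℕ} (hg : InterpFun L f g) (hh : InterpFun L f h) :
    Interp L f fun v => g v < h v := by
  refine (Interp.ex (P := fun v n => g v + n + 1 = h v)
    (hf.eq (hf.add_fun (hf.add_fun (hf.lift hg) (hf.var none)) hf.one) (hf.lift hh))).of_iff
    fun v => ⟨fun h => ?_, ?_⟩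
  · obtain ⟨k, hk⟩ := Nat.exists_eq_add_of_lt h
    exact ⟨k, hk.symm⟩
  · rintro ⟨n, hn⟩
    omega

/-- The definition of `Nat.pair` is by cases and polynomial, hence interpretable. -/
theorem pair [Finite α] {g h : (α → ℕ) → ℕ} (hg : InterpFun L f g) (hh : InterpFun L f h) :
    InterpFun L f fun v => Nat.pair (g v) (h v) := by
  have h1 := hf.lift hg
  have h2 := hf.lift hh
  have hlt := hf.lt h1 h2
  refine (hf.or (hf.and hlt (hf.eq (hf.var none) (hf.add_fun (hf.mul_fun h2 h2) h1)))
    (hf.and (hf.not hlt) (hf.eq (hf.var none)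
      (hf.add_fun (hf.add_fun (hf.mul_fun h1 h1) h1) h2)))).of_iff fun v => ?_
  simp only [Nat.pair]
  split_ifs <;> simp_all

/-- The hypothesis `hpos` excludes the case `a % 0 = a`. -/
theorem mod [Finite α] {g h : (α → ℕ) → ℕ} (hg : InterpFun L f g) (hh : InterpFun L f h)
    (hpos : ∀ v, 0 < h v) : InterpFun L f fun v => g v % h v := by
  have h1 := hf.lift hg
  have h2 := hf.lift hh
  refine (hf.and (hf.lt (hf.var none) h2)
    (Interp.ex (P := fun v q => g (fun i => v (some i)) = h (fun i => v (some i)) * q + v none)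
      (hf.eq (hf.lift h1) (hf.add_fun (hf.mul_fun (hf.lift h2) (hf.var none))
        (hf.var (some none)))))).of_iff fun v => ?_
  constructor
  · intro h
    exact ⟨h ▸ Nat.mod_lt _ (hpos _), _, by rw [h, Nat.div_add_mod]⟩
  · rintro ⟨h3, q, h4⟩
    change v none = g _ % h _
    rw [h4, Nat.mul_add_mod, Nat.mod_eq_of_lt h3]

end ArithInterp

end Arithmetic

end

/-! ### Recursively enumerable sets are interpretable -/

section

variable {L : FirstOrder.Language.{0, 0}} {M : Type} [L.Structure M] {f : ℕ → M} {α : Type}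

/-- Every finite sequence of natural numbers is a sequence of remainders
`i ↦ a % ((i + 1) * b + 1)`: this is Gödel's coding of sequences. -/
theorem exists_mod_eq (s : ℕ → ℕ) (n : ℕ) :
    ∃ a b : ℕ, ∀ i ≤ n, a % ((i + 1) * b + 1) = s i := by
  let l := List.ofFn fun i : Fin (n + 1) => s i
  refine ⟨(Nat.unbeta l).unpair.1, (Nat.unbeta l).unpair.2, fun i hi => ?_⟩
  have := Nat.beta_unbeta_coe l ⟨i, by simpa [l] using Nat.lt_succ_of_le hi⟩
  rw [Nat.beta] at this
  rw [this]
  simp only [l, Fin.getElem_fin, List.getElem_ofFn]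

/-- A value of a function defined by primitive recursion is the last term of a sequence of
intermediate values. -/
theorem mem_rec_iff_exists_seq (F : Part ℕ) (G : ℕ → ℕ → Part ℕ) (n y : ℕ) :
    y ∈ (Nat.rec F (fun i IH => IH.bind (G i)) n : Part ℕ) ↔
      ∃ s : ℕ → ℕ, s 0 ∈ F ∧ (∀ i < n, s (i + 1) ∈ G i (s i)) ∧ s n = y := by
  induction n generalizing y with
  | zero =>
    refine ⟨fun h => ⟨fun _ => y, h, by simp, rfl⟩, ?_⟩
    rintro ⟨s, h, -, rfl⟩
    exact h
  | succ n ih =>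
    simp only [Part.mem_bind_iff, ih]
    constructor
    · rintro ⟨_, ⟨s, h0, hs, rfl⟩, hy⟩
      refine ⟨Function.update s (n + 1) y, ?_, fun i hi => ?_, by simp⟩
      · rwa [Function.update_of_ne (by omega)]
      · rw [Function.update_of_ne (by omega : i ≠ n + 1)]
        rcases Nat.lt_succ_iff_lt_or_eq.1 hi with h | rfl
        · rw [Function.update_of_ne (by omega)]
          exact hs i h
        · rwa [Function.update_self]
    · rintro ⟨s, h0, hs, rfl⟩
      exact ⟨s n, ⟨s, h0, fun i hi => hs i (by omega), rfl⟩, hs n (by omega)⟩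

namespace ArithInterp

variable (hf : ArithInterp L f)
include hf

theorem mod_seq [Finite α] {a b i : (α → ℕ) → ℕ} (ha : InterpFun L f a) (hb : InterpFun L f b)
    (hi : InterpFun L f i) : InterpFun L f fun v => a v % ((i v + 1) * b v + 1) :=
  hf.mod ha (hf.add_fun (hf.mul_fun (hf.add_fun hi hf.one) hb) hf.one) fun _ => Nat.succ_pos _

/-- The graph of a partial recursive function is interpretable. Primitive recursion is the only
case that is not an immediate transcription. -/
theorem graph_partrec {F : ℕ →. ℕ} (hF : Nat.Partrec F) :
    Interp L f fun v : Fin 2 → ℕ => v 1 ∈ F (v 0) := by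
  induction hF with
  | zero => exact (hf.eq (hf.var 1) hf.zero).of_iff fun v => by simp [pure, PFun.pure]
  | succ =>
    exact (hf.eq (hf.var 1) (hf.add_fun (hf.var 0) hf.one)).of_iff fun v => by simp
  | left =>
    refine (Interp.ex (P := fun v b => v 0 = Nat.pair (v 1) b)
      (hf.eq (hf.var (some 0)) (hf.pair (hf.var (some 1)) (hf.var none)))).of_iff fun v => ?_
    simp only [PFun.coe_val, Part.mem_some_iff]
    exact ⟨fun h => ⟨(v 0).unpair.2, by rw [h, Nat.pair_unpair]⟩, fun ⟨b, hb⟩ => by simp [hb]⟩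
  | right =>
    refine (Interp.ex (P := fun v a => v 0 = Nat.pair a (v 1))
      (hf.eq (hf.var (some 0)) (hf.pair (hf.var none) (hf.var (some 1))))).of_iff fun v => ?_
    simp only [PFun.coe_val, Part.mem_some_iff]
    exact ⟨fun h => ⟨(v 0).unpair.1, by rw [h, Nat.pair_unpair]⟩, fun ⟨b, hb⟩ => by simp [hb]⟩
  | @pair F G _ _ hF hG =>
    refine (Interp.ex (P := fun v a => ∃ b, a ∈ F (v 0) ∧ b ∈ G (v 0) ∧ v 1 = Nat.pair a b)
      (Interp.ex (P := fun v b => v none ∈ F (v (some 0)) ∧ b ∈ G (v (some 0)) ∧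
          v (some 1) = Nat.pair (v none) b)
        (hf.and (hf.reindex hF ![some (some 0), some none])
          (hf.and (hf.reindex hG ![some (some 0), none])
            (hf.eq (hf.var (some (some 1))) (hf.pair (hf.var (some none)) (hf.var none))))))).of_iff
      fun v => ?_
    simp only [Seq.seq, Part.mem_bind_iff, Part.map_eq_map, Part.mem_map_iff]
    constructor
    · rintro ⟨_, ⟨a, ha, rfl⟩, b, hb, h⟩
      exact ⟨a, b, ha, hb, h.symm⟩
    · rintro ⟨a, b, ha, hb, h⟩
      exact ⟨_, ⟨a, ha, rfl⟩, b, hb, h.symm⟩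
  | @comp F G _ _ hF hG =>
    exact (Interp.ex (P := fun v a => a ∈ G (v 0) ∧ v 1 ∈ F a)
      (hf.and (hf.reindex hG ![some 0, none]) (hf.reindex hF ![none, some 1]))).of_iff
      fun v => Part.mem_bind_iff
  | @prec F G _ _ hF hG =>
    -- The variables are `v 0`, `v 1`, then the arguments `a`, `n`, then the numbers `c`, `d` that
    -- code the sequence of intermediate values.
    have key := Interp.ex (α := Fin 2) (P := fun v a => ∃ n c d,
        v 0 = Nat.pair a n ∧ c % ((0 + 1) * d + 1) ∈ F a ∧
        (∀ i, i < n → c % ((i + 1 + 1) * d + 1) ∈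
          G (Nat.pair a (Nat.pair i (c % ((i + 1) * d + 1))))) ∧
        v 1 = c % ((n + 1) * d + 1)) <|
      Interp.ex (P := fun v n => ∃ c d, v (some 0) = Nat.pair (v none) n ∧
        c % ((0 + 1) * d + 1) ∈ F (v none) ∧
        (∀ i, i < n → c % ((i + 1 + 1) * d + 1) ∈
          G (Nat.pair (v none) (Nat.pair i (c % ((i + 1) * d + 1))))) ∧
        v (some 1) = c % ((n + 1) * d + 1)) <|
      Interp.ex (P := fun v c => ∃ d, v (some (some 0)) = Nat.pair (v (some none)) (v none) ∧
        c % ((0 + 1) * d + 1) ∈ F (v (some none)) ∧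
        (∀ i, i < v none → c % ((i + 1 + 1) * d + 1) ∈
          G (Nat.pair (v (some none)) (Nat.pair i (c % ((i + 1) * d + 1))))) ∧
        v (some (some 1)) = c % ((v none + 1) * d + 1)) <|
      Interp.ex (P := fun v d => v (some (some (some 0))) =
          Nat.pair (v (some (some none))) (v (some none)) ∧
        v none % ((0 + 1) * d + 1) ∈ F (v (some (some none))) ∧
        (∀ i, i < v (some none) → v none % ((i + 1 + 1) * d + 1) ∈
          G (Nat.pair (v (some (some none))) (Nat.pair i (v none % ((i + 1) * d + 1))))) ∧
        v (some (some (some 1))) = v none % ((v (some none) + 1) * d + 1)) <|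
      hf.and (hf.eq (hf.var _) (hf.pair (hf.var _) (hf.var _))) <|
      hf.and (hf.subst₂ (R := fun x y => y ∈ F x) hF (hf.var _)
        (hf.mod_seq (hf.var _) (hf.var _) hf.zero)) <|
      hf.and (hf.all (P := fun v i => i < v (some (some none)) →
          v (some none) % ((i + 1 + 1) * v none + 1) ∈ G (Nat.pair (v (some (some (some none))))
            (Nat.pair i (v (some none) % ((i + 1) * v none + 1)))))
        (hf.imp (hf.lt (hf.var _) (hf.var _)) <|
          hf.subst₂ (R := fun x y => y ∈ G x) hG
            (hf.pair (hf.var _) (hf.pair (hf.var _) (hf.mod_seq (hf.var _) (hf.var _) (hf.var _))))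
            (hf.mod_seq (hf.var _) (hf.var _) (hf.add_fun (hf.var _) hf.one)))) <|
      hf.eq (hf.var _) (hf.mod_seq (hf.var _) (hf.var _) (hf.var _))
    refine key.of_iff fun v => ?_
    have hrec := mem_rec_iff_exists_seq (F (v 0).unpair.1)
      (fun i z => G (Nat.pair (v 0).unpair.1 (Nat.pair i z))) (v 0).unpair.2 (v 1)
    refine Iff.trans hrec ⟨?_, ?_⟩
    · rintro ⟨s, h0, hs, hn⟩
      obtain ⟨c, d, hcd⟩ := exists_mod_eq s (v 0).unpair.2
      refine ⟨_, _, c, d, (Nat.pair_unpair _).symm, ?_, fun i hi => ?_, ?_⟩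
      · rwa [hcd 0 (Nat.zero_le _)]
      · rw [hcd i hi.le, hcd (i + 1) hi]
        exact hs i hi
      · rw [hcd _ le_rfl, hn]
    · rintro ⟨a, n, c, d, h, h0, hs, hn⟩
      rw [h, Nat.unpair_pair]
      exact ⟨fun i => c % ((i + 1) * d + 1), h0, hs, hn.symm⟩
  | @rfind F _ hF =>
    refine (hf.and (hf.subst₂ (R := fun x y => y ∈ F x) hF
        (hf.pair (hf.var (0 : Fin 2)) (hf.var 1)) hf.zero)
      (hf.all (P := fun v m => m < v 1 → ∃ z, z ∈ F (Nat.pair (v 0) m) ∧ ¬ z = 0)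
        (hf.imp (hf.lt (hf.var none) (hf.var (some 1)))
          (Interp.ex (P := fun v z => z ∈ F (Nat.pair (v (some 0)) (v none)) ∧ ¬ z = 0)
            (hf.and (hf.subst₂ (R := fun x y => y ∈ F x) hF
              (hf.pair (hf.var (some (some 0))) (hf.var (some none))) (hf.var none))
              (hf.not (hf.eq (hf.var none) hf.zero))))))).of_iff fun v => ?_
    refine Nat.mem_rfind.trans ?_
    simp

/-- Recursively enumerable sets of natural numbers are interpretable. -/
theorem dom_partrec {F : ℕ →. ℕ} (hF : Nat.Partrec F) {i : α} [Finite α] :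
    Interp L f fun v : α → ℕ => (F (v i)).Dom :=
  (Interp.ex (P := fun v y => y ∈ F (v i)) (hf.reindex (hf.graph_partrec hF) ![some i, none])).of_iff
    fun _ => Part.dom_iff_mem

end ArithInterp

end

/-! ### Numerals, Gödel numbers and undecidability -/

section

open FirstOrder.Language

variable {L : FirstOrder.Language.{0, 0}} [Encodable (Σ n, L.Functions n)]
  [Encodable (Σ n, L.Relations n)] {M : Type} [L.Structure M] {f : ℕ → M}

/-- The list of the numbers of the symbols that spell a formula. -/
def symbolCodes {n : ℕ} (φ : L.BoundedFormula Empty n) : List ℕ :=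
  φ.listEncode.map Encodable.encode

/-- The number of a list depends only on the numbers of its entries. -/
theorem encode_map_encode {α : Type} [Encodable α] (l : List α) :
    Encodable.encode (l.map Encodable.encode) = Encodable.encode l := by
  induction l with
  | nil => rfl
  | cons a l ih => rw [List.map_cons, Encodable.encode_list_cons, ih, Encodable.encode_list_cons,
      Encodable.encode_nat]

theorem godelNumber_eq (φ : L.Sentence) :
    godelNumber φ = Encodable.encode (symbolCodes (n := 0) φ) :=
  (encode_map_encode _).symm

/-- `BoundedFormula.listEncode` spells `→` as `inr (inr 0)`, which has the number
`2 * (2 * 0 + 1) + 1 = 3`. -/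
theorem symbolCodes_imp {n : ℕ} (φ χ : L.BoundedFormula Empty n) :
    symbolCodes (φ.imp χ) = 3 :: (symbolCodes φ ++ symbolCodes χ) := by
  simp [symbolCodes, BoundedFormula.listEncode]

/-- `BoundedFormula.listEncode` spells `∀` as `inr (inr 1)`, which has the number
`2 * (2 * 1 + 1) + 1 = 7`. -/
theorem symbolCodes_all {n : ℕ} (φ : L.BoundedFormula Empty (n + 1)) :
    symbolCodes φ.all = 7 :: symbolCodes φ := by
  simp [symbolCodes, BoundedFormula.listEncode]

/-- Given formulas `σ k` that express `x_{k+2} + x_0 = x_{k+3}`, the formula `numeralNe σ n k`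
expresses, when `x_0` is `1`, that `x_1` differs from `x_{k+2} + n`:
`∀ x_{k+3}, x_{k+2} + x_0 = x_{k+3} → ⋯ → ∀ x_{k+n+2}, x_{k+n+1} + x_0 = x_{k+n+2} →
x_1 ≠ x_{k+n+2}`. -/
def numeralNe (σ : ∀ k, L.BoundedFormula Empty (k + 4)) :
    ℕ → ∀ k, L.BoundedFormula Empty (k + 3)
  | 0, k => (BoundedFormula.equal (.var (.inr 1)) (.var (.inr (Fin.last (k + 2))))).imp .falsum
  | n + 1, k => ((σ k).imp (numeralNe σ n (k + 1))).all

omit [Encodable (Σ n, L.Functions n)] [Encodable (Σ n, L.Relations n)] in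
theorem realize_numeralNe (hf : Function.Injective f) {σ : ∀ k, L.BoundedFormula Empty (k + 4)}
    (hσ : ∀ (k a : ℕ) (xs : Fin (k + 3) → M) (z : M), xs 0 = f 1 → xs (Fin.last (k + 2)) = f a →
      ((σ k).Realize default (Fin.snoc xs z) ↔ z = f (a + 1)))
    (n k a m : ℕ) (xs : Fin (k + 3) → M) (h0 : xs 0 = f 1) (h1 : xs 1 = f m)
    (ha : xs (Fin.last (k + 2)) = f a) :
    (numeralNe σ n k).Realize default xs ↔ m ≠ a + n := by
  induction n generalizing k a with
  | zero =>
    simp only [numeralNe, BoundedFormula.Realize, Term.realize_var, Sum.elim_inr, h1, ha,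
      hf.eq_iff, add_zero]
  | succ n ih =>
    have hz : ∀ z : M, (Fin.snoc xs z : Fin (k + 1 + 3) → M) 0 = xs 0 ∧
        (Fin.snoc xs z : Fin (k + 1 + 3) → M) 1 = xs 1 ∧
        (Fin.snoc xs z : Fin (k + 1 + 3) → M) (Fin.last (k + 1 + 2)) = z := fun z =>
      ⟨Fin.snoc_castSucc (α := fun _ => M) z xs 0, Fin.snoc_castSucc (α := fun _ => M) z xs 1,
        Fin.snoc_last (α := fun _ => M) z xs⟩
    have : (numeralNe σ (n + 1) k).Realize default xs ↔ ∀ z : M,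
        (σ k).Realize default (Fin.snoc xs z) →
          (numeralNe σ n (k + 1)).Realize default (Fin.snoc xs z : Fin (k + 1 + 3) → M) := Iff.rfl
    rw [this]
    simp only [hσ k a xs _ h0 ha, forall_eq]
    obtain ⟨h2, h3, h4⟩ := hz (f (a + 1))
    rw [ih (k + 1) (a + 1) _ (h2.trans h0) (h3.trans h1) h4, add_right_comm, add_assoc]

/-- The formula `numeralNe σ n k` is a chain of `n` guarded universal quantifiers in prefix notation,
so that its code is a concatenation. -/
theorem symbolCodes_numeralNe (σ : ∀ k, L.BoundedFormula Empty (k + 4)) (n k : ℕ) :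
    symbolCodes (numeralNe σ n k) =
      (List.range n).flatMap (fun i => 7 :: 3 :: symbolCodes (σ (k + i))) ++
        symbolCodes (numeralNe σ 0 (k + n)) := by
  induction n generalizing k with
  | zero => rfl
  | succ n ih =>
    have h : symbolCodes (numeralNe σ (n + 1) k) =
        7 :: 3 :: (symbolCodes (σ k) ++ symbolCodes (numeralNe σ n (k + 1))) := by
      rw [numeralNe, symbolCodes_all, symbolCodes_imp]
    rw [List.range_succ_eq_map, h, ih]
    have h1 : ∀ i, symbolCodes (σ (k + 1 + i)) = symbolCodes (σ (k + (i + 1))) := fun i => by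
      rw [show k + 1 + i = k + (i + 1) by omega]
    have h2 : symbolCodes (numeralNe σ 0 (k + 1 + n)) =
        symbolCodes (numeralNe σ 0 (k + (n + 1))) := by
      rw [show k + 1 + n = k + (n + 1) by omega]
    simp [List.flatMap_map, h1, h2]

theorem primrec_symbolCodes_numeralNe {σ : ∀ k, L.BoundedFormula Empty (k + 4)}
    (hσ : Primrec fun k => symbolCodes (σ k)) :
    Primrec fun n => symbolCodes (numeralNe σ n 0) := by
  have h0 : Primrec fun k => symbolCodes (numeralNe σ 0 k) := by
    -- The symbol `→`, the variables `x_1` and `x_{k+2}` in the context of `k + 3` variables, and `⊥`.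
    have h : ∀ k, symbolCodes (numeralNe σ 0 k) =
        [3, 2 * Nat.pair (k + 3) (Nat.pair (2 * (2 * 1 + 1)) 0 + 1),
          2 * Nat.pair (k + 3) (Nat.pair (2 * (2 * (k + 2) + 1)) 0 + 1),
          2 * (2 * (k + 5) + 1) + 1] := fun k => rfl
    have hk : ∀ c, Primrec fun k : ℕ => k + c := fun c =>
      Primrec.nat_add.comp Primrec.id (Primrec.const c)
    refine Primrec.of_eq ?_ fun k => (h k).symm
    refine Primrec.list_cons.comp (Primrec.const _) <| Primrec.list_cons.comp
      (Primrec.nat_double.comp (Primrec₂.natPair.comp (hk 3) (Primrec.const _))) <|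
      Primrec.list_cons.comp (Primrec.nat_double.comp (Primrec₂.natPair.comp (hk 3)
        (Primrec.succ.comp (Primrec₂.natPair.comp
          (Primrec.nat_double.comp (Primrec.nat_double_succ.comp (hk 2))) (Primrec.const 0))))) <|
      Primrec.list_cons.comp (Primrec.nat_double_succ.comp (Primrec.nat_double_succ.comp (hk 5)))
        (Primrec.const [])
  refine Primrec.of_eq ?_ fun n => (symbolCodes_numeralNe σ n 0).symm
  exact Primrec.list_append.comp (Primrec.list_flatMap Primrec.list_range
    (Primrec.list_cons.comp (Primrec.const 7) (Primrec.list_cons.comp (Primrec.const 3)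
      (hσ.comp
      (Primrec.nat_add.comp (Primrec.const 0) Primrec.snd)))).to₂)
    (h0.comp (Primrec.nat_add.comp (Primrec.const 0) Primrec.id))

/-- A structure in which arithmetic is interpretable has an undecidable theory. The halting
problem reduces to its theory, by means of the sentences that say `n ∉ H` for a definable set `H`.
The formulas `σ k` express `x_{k+2} + x_0 = x_{k+3}` for codes of natural numbers and serve to write
down the numerals. -/
theorem ArithInterp.not_decidableTheory (hf : ArithInterp L f)
    {σ : ∀ k, L.BoundedFormula Empty (k + 4)}
    (hσ : ∀ (k a : ℕ) (xs : Fin (k + 3) → M) (z : M), xs 0 = f 1 → xs (Fin.last (k + 2)) = f a →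
      ((σ k).Realize default (Fin.snoc xs z) ↔ z = f (a + 1)))
    (hcode : Primrec fun k => symbolCodes (σ k)) : ¬ DecidableTheory L M := by
  intro hdec
  let F : ℕ →. ℕ := fun n => (Denumerable.ofNat Nat.Partrec.Code n).eval 0
  have hF : Nat.Partrec F := Partrec.nat_iff.1
    (Nat.Partrec.Code.eval_part.comp (Computable.ofNat _) (Computable.const 0))
  have hH : Interp L f fun v : Fin 3 → ℕ => v 0 = 1 ∧ (F (v 1)).Dom ∧ v 2 = 0 :=
    hf.and (hf.eq (hf.var 0) hf.one)
      (hf.and (hf.dom_partrec hF) (hf.eq (hf.var 2) hf.zero))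
  -- `x_0 = 1`, `x_1` is in the halting set, and the chain that counts up to `n` starts at `x_2 = 0`.
  obtain ⟨φ, hφ⟩ := Set.empty_definable_iff.1 hH
  let φ' : L.BoundedFormula Empty 3 := BoundedFormula.relabel Sum.inr φ
  let S : ℕ → L.Sentence := fun n => (φ'.imp (numeralNe σ n 0)).alls
  have hS : ∀ n, M ⊨ S n ↔ ¬ (F n).Dom := by
    intro n
    have h1 : M ⊨ S n ↔ ∀ xs : Fin 3 → M, φ.Realize xs →
        (numeralNe σ n 0).Realize default xs :=
      BoundedFormula.realize_alls.trans
        (forall_congr' fun xs => imp_congr (Formula.realize_relabel_sumInr φ) Iff.rfl)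
    have h2 : ∀ xs : Fin 3 → M, φ.Realize xs ↔
        ∃ v : Fin 3 → ℕ, (v 0 = 1 ∧ (F (v 1)).Dom ∧ v 2 = 0) ∧ f ∘ v = xs :=
      fun xs => (Set.ext_iff.1 hφ xs).symm
    have h3 : ∀ v : Fin 3 → ℕ, v 0 = 1 → v 2 = 0 →
        ((numeralNe σ n 0).Realize default (f ∘ v) ↔ v 1 ≠ n) := by
      intro v h0 h2
      rw [realize_numeralNe hf.inj hσ n 0 0 (v 1) (f ∘ v) (congrArg f h0) rfl (congrArg f h2),
        zero_add]
    rw [h1]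
    constructor
    · intro h hn
      exact (h3 ![1, n, 0] rfl rfl).1 (h _ ((h2 _).2 ⟨![1, n, 0], ⟨rfl, hn, rfl⟩, rfl⟩)) rfl
    · intro hn xs hxs
      obtain ⟨v, ⟨h0, hv, h0'⟩, rfl⟩ := (h2 xs).1 hxs
      exact (h3 v h0 h0').2 fun h => hn (h ▸ hv)
  have hcomp : Computable fun n => godelNumber (S n) := by
    have : ∀ n, symbolCodes (n := 0) (S n) =
        [7, 7, 7, 3] ++ symbolCodes φ' ++ symbolCodes (numeralNe σ n 0) := fun n => by
      change symbolCodes (φ'.imp (numeralNe σ n 0)).all.all.all = _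
      rw [symbolCodes_all, symbolCodes_all, symbolCodes_all, symbolCodes_imp]
      rfl
    simp only [godelNumber_eq, this]
    exact (Primrec.encode.comp (Primrec.list_append.comp (Primrec.const _)
      (primrec_symbolCodes_numeralNe hcode))).to_comp
  have hnot : ComputablePred fun n => ¬ (F n).Dom :=
    ComputablePred.computable_of_manyOneReducible (q := _)
      ⟨_, hcomp, fun n => (hS n).symm.trans
        ⟨fun h => ⟨S n, h, rfl⟩, fun ⟨φ, h, he⟩ => godelNumber_injective he ▸ h⟩⟩ hdec
  refine ComputablePred.halting_problem 0 (ComputablePred.computable_of_manyOneReducible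
    (q := fun n => (F n).Dom) ⟨Encodable.encode, Computable.encode, fun c => ?_⟩ ?_)
  · simp [F]
  · simpa using hnot.not

end

/-! ### Arithmetic in the ring of adeles with a character -/

section

open FirstOrder.Language

/-- An adele is a natural number if and only if it is a sum of four squares of integers. -/
theorem exists_nat_iff_sum_four_sq (x : RatAdele) :
    (∃ n : ℕ, n = x) ↔ ∃ r s : RatAdele,
      (∃ a b : RatAdele, (∃ n : ℤ, a = n) ∧ (∃ n : ℤ, b = n) ∧ a * a + b * b = r) ∧
      (∃ a b : RatAdele, (∃ n : ℤ, a = n) ∧ (∃ n : ℤ, b = n) ∧ a * a + b * b = s) ∧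
      r + s = x := by
  constructor
  · rintro ⟨n, rfl⟩
    obtain ⟨a, b, c, d, h⟩ := Nat.sum_four_squares n
    refine ⟨_, _, ⟨a, b, ⟨a, by simp⟩, ⟨b, by simp⟩, rfl⟩, ⟨c, d, ⟨c, by simp⟩, ⟨d, by simp⟩, rfl⟩,
      ?_⟩
    rw [← h]
    push_cast
    ring
  · rintro ⟨_, _, ⟨_, _, ⟨a, rfl⟩, ⟨b, rfl⟩, rfl⟩, ⟨_, _, ⟨c, rfl⟩, ⟨d, rfl⟩, rfl⟩, rfl⟩
    refine ⟨(a * a + b * b + (c * c + d * d)).toNat, ?_⟩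
    have h : ((a * a + b * b + (c * c + d * d)).toNat : ℤ) = a * a + b * b + (c * c + d * d) :=
      Int.toNat_of_nonneg (by nlinarith [sq_nonneg a, sq_nonneg b, sq_nonneg c, sq_nonneg d])
    have h' := congrArg (Int.cast : ℤ → RatAdele) h
    push_cast at h'
    exact h'

theorem ratAdele_natCast_injective : Function.Injective (Nat.cast : ℕ → RatAdele) := by
  intro m n h
  have := congrArg realComponent h
  have hm := realComponent_intCast m
  have hn := realComponent_intCast n
  rw [Int.cast_natCast] at hm hn
  rw [hm, hn] at this
  exact_mod_cast this

/-- A coding of the adeles for which the ring operations and the kernel of `ψ` are definable. -/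
structure AdeleInterp (L : FirstOrder.Language.{0, 0}) {M : Type} [L.Structure M]
    (ι : RatAdele → M) : Prop extends Coding L ι where
  add : Interp L ι fun v : Fin 3 → RatAdele => v 0 + v 1 = v 2
  mul : Interp L ι fun v : Fin 3 → RatAdele => v 0 * v 1 = v 2
  char : Interp L ι fun v : Fin 1 → RatAdele => ratAdeleChar (v 0) = 1

/-- A relation on natural numbers is interpretable if it is interpretable as a relation on
adeles. -/
theorem interp_natCast {L : FirstOrder.Language.{0, 0}} {M : Type} [L.Structure M]
    {ι : RatAdele → M} {α : Type} {P : (α → ℕ) → Prop} {Q : (α → RatAdele) → Prop}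
    (hQ : Interp L ι Q) (h : ∀ w, Q w ↔ ∃ v : α → ℕ, P v ∧ (fun i => (v i : RatAdele)) = w) :
    Interp L (fun n : ℕ => ι n) P := by
  rw [Interp] at hQ ⊢
  convert! hQ using 1
  ext w
  constructor
  · rintro ⟨v, hv, rfl⟩
    exact ⟨_, (h _).2 ⟨v, hv, rfl⟩, rfl⟩
  · rintro ⟨_, hw, rfl⟩
    obtain ⟨v, hv, rfl⟩ := (h _).1 hw
    exact ⟨v, hv, rfl⟩

namespace AdeleInterp

variable {L : FirstOrder.Language.{0, 0}} {M : Type} [L.Structure M] {ι : RatAdele → M}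
  (hι : AdeleInterp L ι)
include hι

theorem int {α : Type} [Finite α] (i : α) :
    Interp L ι fun v : α → RatAdele => ∃ n : ℤ, v i = n := by
  refine (hι.all (P := fun v y => ratAdeleChar y = 1 → ∃ z, v i * y = z ∧ ratAdeleChar z = 1)
    (hι.imp (hι.reindex hι.char ![none]) (Interp.ex
      (P := fun v z => v (some i) * v none = z ∧ ratAdeleChar z = 1)
      (hι.and (hι.reindex hι.mul ![some (some i), some none, none])
        (hι.reindex hι.char ![none]))))).of_iff fun v => ?_
  rw [exists_int_iff_forall_ratAdeleChar]
  simp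

theorem sum_two_sq {α : Type} [Finite α] (i : α) :
    Interp L ι fun v : α → RatAdele => ∃ a b : RatAdele, (∃ n : ℤ, a = n) ∧ (∃ n : ℤ, b = n) ∧
      a * a + b * b = v i := by
  refine Interp.ex (P := fun v (a : RatAdele) => ∃ b : RatAdele, (∃ n : ℤ, a = n) ∧ (∃ n : ℤ, b = n) ∧
    a * a + b * b = v i) <| Interp.ex (P := fun v (b : RatAdele) => (∃ n : ℤ, v none = n) ∧
      (∃ n : ℤ, b = n) ∧ v none * v none + b * b = v (some i)) <|
    hι.and (hι.int _) (hι.and (hι.int _) ?_)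
  refine (Interp.ex (P := fun v p => ∃ q, v (some none) * v (some none) = p ∧
      v none * v none = q ∧ p + q = v (some (some i))) <|
    Interp.ex (P := fun v q => v (some (some none)) * v (some (some none)) = v none ∧
      v (some none) * v (some none) = q ∧ v none + q = v (some (some (some i)))) <|
    hι.and (hι.reindex hι.mul ![some (some (some none)), some (some (some none)), some none]) <|
    hι.and (hι.reindex hι.mul ![some (some none), some (some none), none])
      (hι.reindex hι.add ![some none, none, some (some (some (some i)))])).of_iff fun v => ?_
  simp

theorem nat {α : Type} [Finite α] (i : α) :
    Interp L ι fun v : α → RatAdele => ∃ n : ℕ, n = v i := by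
  have h := Interp.ex (L := L) (f := ι) (α := α) (P := fun v r => ∃ s : RatAdele,
      (∃ a b : RatAdele, (∃ n : ℤ, a = n) ∧ (∃ n : ℤ, b = n) ∧ a * a + b * b = r) ∧
      (∃ a b : RatAdele, (∃ n : ℤ, a = n) ∧ (∃ n : ℤ, b = n) ∧ a * a + b * b = s) ∧
      r + s = v i) <|
    Interp.ex (P := fun v s =>
      (∃ a b : RatAdele, (∃ n : ℤ, a = n) ∧ (∃ n : ℤ, b = n) ∧ a * a + b * b = v none) ∧
      (∃ a b : RatAdele, (∃ n : ℤ, a = n) ∧ (∃ n : ℤ, b = n) ∧ a * a + b * b = s) ∧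
      v none + s = v (some i)) <|
    hι.and (hι.sum_two_sq (some none)) <| hι.and (hι.sum_two_sq none) <|
      hι.reindex hι.add ![some none, none, some (some i)]
  exact h.of_iff fun v => exists_nat_iff_sum_four_sq (v i)

/-- Arithmetic is interpretable wherever the ring of adeles and the kernel of `ψ` are. -/
theorem arithInterp : ArithInterp L fun n : ℕ => ι n where
  inj := hι.inj.comp ratAdele_natCast_injective
  univ := interp_natCast (hι.nat 0) fun w =>
    ⟨fun ⟨n, hn⟩ => ⟨fun _ => n, trivial, funext fun i => by rw [hn, Subsingleton.elim i 0]⟩,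
      fun ⟨v, _, hv⟩ => ⟨v 0, congrFun hv 0⟩⟩
  add := interp_natCast (hι.and (hι.nat 0) (hι.and (hι.nat 1) (hι.and (hι.nat 2) hι.add)))
    fun w => by
      constructor
      · rintro ⟨⟨a, ha⟩, ⟨b, hb⟩, ⟨c, hc⟩, h⟩
        refine ⟨![a, b, c], ratAdele_natCast_injective ?_,
          funext fun i => by fin_cases i <;> assumption⟩
        rw [← ha, ← hb, ← hc] at h
        simpa using h
      · rintro ⟨v, h, rfl⟩
        exact ⟨⟨_, rfl⟩, ⟨_, rfl⟩, ⟨_, rfl⟩, by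
          simpa using congrArg (Nat.cast : ℕ → RatAdele) h⟩
  mul := interp_natCast (hι.and (hι.nat 0) (hι.and (hι.nat 1) (hι.and (hι.nat 2) hι.mul)))
    fun w => by
      constructor
      · rintro ⟨⟨a, ha⟩, ⟨b, hb⟩, ⟨c, hc⟩, h⟩
        refine ⟨![a, b, c], ratAdele_natCast_injective ?_,
          funext fun i => by fin_cases i <;> assumption⟩
        rw [← ha, ← hb, ← hc] at h
        simpa using h
      · rintro ⟨v, h, rfl⟩
        exact ⟨⟨_, rfl⟩, ⟨_, rfl⟩, ⟨_, rfl⟩, by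
          simpa using congrArg (Nat.cast : ℕ → RatAdele) h⟩

end AdeleInterp

end

/-! ### The two structures -/

section

open FirstOrder.Language

theorem interp_id {L : FirstOrder.Language.{0, 0}} {M : Type} [L.Structure M] {α : Type}
    {P : (α → M) → Prop} (φ : L.Formula α) (h : ∀ v, φ.Realize v ↔ P v) :
    Interp L (id : M → M) P := by
  refine Set.empty_definable_iff.2 ⟨φ, ?_⟩
  ext v
  simp [h]

/-- The sum of two terms. -/
def addTerm {α : Type} (s t : ringWithPredicate.Term α) : ringWithPredicate.Term α :=
  Functions.apply₂ (L := ringWithPredicate) ringFunc.add s t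

/-- The product of two terms. -/
def mulTerm {α : Type} (s t : ringWithPredicate.Term α) : ringWithPredicate.Term α :=
  Functions.apply₂ (L := ringWithPredicate) ringFunc.mul s t

theorem realize_addTerm {α : Type} (s t : ringWithPredicate.Term α) (v : α → RatAdele) :
    (addTerm s t).realize v = s.realize v + t.realize v :=
  Term.realize_functions_apply₂

theorem realize_mulTerm {α : Type} (s t : ringWithPredicate.Term α) (v : α → RatAdele) :
    (mulTerm s t).realize v = s.realize v * t.realize v :=
  Term.realize_functions_apply₂

theorem adeleInterp_ringWithPredicate : AdeleInterp ringWithPredicate (id : RatAdele → RatAdele)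
    where
  inj := Function.injective_id
  univ := interp_id ⊤ fun _ => by simp
  add := interp_id ((addTerm (.var 0) (.var 1)).equal (.var 2)) fun v => by
    simp [realize_addTerm]
  mul := interp_id ((mulTerm (.var 0) (.var 1)).equal (.var 2)) fun v => by
    simp [realize_mulTerm]
  char := interp_id (Relations.formula (L := ringWithPredicate) CharRel.char .var)
    fun v => Formula.realize_rel

theorem not_decidableTheory_ringWithPredicate : ¬ DecidableTheory ringWithPredicate RatAdele := by
  refine adeleInterp_ringWithPredicate.arithInterp.not_decidableTheory
    (σ := fun k => BoundedFormula.equal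
      (addTerm (.var (.inr (Fin.castSucc (Fin.last (k + 2))))) (.var (.inr (Fin.castSucc 0))))
      (.var (.inr (Fin.last (k + 3))))) ?_ ?_
  · intro k a xs z h0 ha
    simp only [BoundedFormula.Realize, realize_addTerm, Term.realize_var, Sum.elim_inr,
      Fin.snoc_castSucc, Fin.snoc_last, h0, ha]
    simp [eq_comm]
  · -- The two sides of the equation `x_{k+2} + x_0 = x_{k+3}`; the symbol `+` has the number `0`.
    have h : ∀ k, symbolCodes (L := ringWithPredicate) (BoundedFormula.equal
      (addTerm (.var (.inr (Fin.castSucc (Fin.last (k + 2))))) (.var (.inr (Fin.castSucc 0))))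
      (.var (.inr (Fin.last (k + 3))))) =
        [2 * Nat.pair (k + 4) (Nat.pair (2 * 0 + 1) (Nat.pair (2 * (2 * (k + 2) + 1))
            (Nat.pair (2 * (2 * 0 + 1)) 0 + 1) + 1) + 1),
          2 * Nat.pair (k + 4) (Nat.pair (2 * (2 * (k + 3) + 1)) 0 + 1)] := fun k => rfl
    have hk : ∀ c, Primrec fun k : ℕ => k + c := fun c =>
      Primrec.nat_add.comp Primrec.id (Primrec.const c)
    have hvar : ∀ c, Primrec fun k : ℕ => 2 * (2 * (k + c) + 1) := fun c =>
      Primrec.nat_double.comp (Primrec.nat_double_succ.comp (hk c))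
    refine Primrec.of_eq ?_ fun k => (h k).symm
    exact Primrec.list_cons.comp (Primrec.nat_double.comp (Primrec₂.natPair.comp (hk 4)
        (Primrec.succ.comp (Primrec₂.natPair.comp (Primrec.const _) (Primrec.succ.comp
          (Primrec₂.natPair.comp (hvar 2) (Primrec.const _))))))) <|
      Primrec.list_cons.comp (Primrec.nat_double.comp (Primrec₂.natPair.comp (hk 4)
        (Primrec.succ.comp (Primrec₂.natPair.comp (hvar 3) (Primrec.const _))))) (Primrec.const [])

theorem definable_rel {L : FirstOrder.Language.{0, 0}} {M : Type} [L.Structure M] {n : ℕ}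
    (R : L.Relations n) {s : Set (Fin n → M)} (h : ∀ v, v ∈ s ↔ Structure.RelMap R v) :
    (∅ : Set M).Definable L s := by
  refine Set.empty_definable_iff.2 ⟨R.formula .var, ?_⟩
  ext v
  simp [h, Formula.realize_rel]

theorem fin_three_eq {M : Type} {v w : Fin 3 → M} (h0 : v 0 = w 0) (h1 : v 1 = w 1)
    (h2 : v 2 = w 2) : v = w :=
  funext fun i => by fin_cases i <;> assumption

theorem adeleInterp_twoSorted :
    AdeleInterp twoSorted (Sum.inl : RatAdele → RatAdele ⊕ ℂ) where
  inj := Sum.inl_injective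
  univ := by
    refine definable_rel (L := twoSorted) TwoSortedRel.isRing fun v => ?_
    change _ ↔ ∃ a, v 0 = .inl a
    constructor
    · rintro ⟨u, -, rfl⟩
      exact ⟨u 0, rfl⟩
    · rintro ⟨a, ha⟩
      exact ⟨fun _ => a, trivial, funext fun i => by rw [Subsingleton.elim i 0, ha]; rfl⟩
  add := by
    refine definable_rel (L := twoSorted) TwoSortedRel.addRing fun v => ?_
    change _ ↔ ∃ a b, v 0 = .inl a ∧ v 1 = .inl b ∧ v 2 = .inl (a + b)
    constructor
    · rintro ⟨u, hu, rfl⟩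
      exact ⟨u 0, u 1, rfl, rfl, congrArg Sum.inl (Eq.symm hu)⟩
    · rintro ⟨a, b, h0, h1, h2⟩
      exact ⟨![a, b, a + b], rfl, fin_three_eq h0.symm h1.symm h2.symm⟩
  mul := by
    refine definable_rel (L := twoSorted) TwoSortedRel.mulRing fun v => ?_
    change _ ↔ ∃ a b, v 0 = .inl a ∧ v 1 = .inl b ∧ v 2 = .inl (a * b)
    constructor
    · rintro ⟨u, hu, rfl⟩
      exact ⟨u 0, u 1, rfl, rfl, congrArg Sum.inl (Eq.symm hu)⟩
    · rintro ⟨a, b, h0, h1, h2⟩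
      exact ⟨![a, b, a * b], rfl, fin_three_eq h0.symm h1.symm h2.symm⟩
  char := by
    -- The number `1` is the only complex number `z` with `z * z = z` and `z + z ≠ z`.
    have h1 := (definable_rel (L := twoSorted) (M := RatAdele ⊕ ℂ) TwoSortedRel.mulField
      fun v => Iff.rfl).preimage_comp ![(1 : Fin 2), 1, 1]
    have h2 := (definable_rel (L := twoSorted) (M := RatAdele ⊕ ℂ) TwoSortedRel.addField
      fun v => Iff.rfl).preimage_comp ![(1 : Fin 2), 1, 1]
    have h3 := definable_rel (L := twoSorted) (M := RatAdele ⊕ ℂ) TwoSortedRel.char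
      fun v => Iff.rfl
    have h := ((h3.inter h1).sdiff h2).image_comp (fun _ : Fin 1 => (0 : Fin 2))
    rw [Interp]
    convert! h using 1
    ext v
    constructor
    · rintro ⟨u, hu, rfl⟩
      refine ⟨![.inl (u 0), .inr 1], ⟨⟨⟨u 0, rfl, ?_⟩, 1, 1, rfl, rfl, ?_⟩, ?_⟩,
        funext fun i => by rw [Subsingleton.elim i 0]; rfl⟩
      · exact congrArg Sum.inr (Eq.symm hu)
      · exact congrArg Sum.inr (mul_one (1 : ℂ)).symm
      · rintro ⟨z, w, hz, hw, hzw⟩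
        obtain rfl : 1 = z := Sum.inr_injective hz
        obtain rfl : 1 = w := Sum.inr_injective hw
        have : (1 : ℂ) = 1 + 1 := Sum.inr_injective hzw
        norm_num at this
    · rintro ⟨w, ⟨⟨⟨a, h0, hz⟩, y, z, hy, hz', hyz⟩, hadd⟩, rfl⟩
      change w 1 = _ at hz hy hz' hyz
      have e1 : ratAdeleChar a = y := Sum.inr_injective (hz.symm.trans hy)
      have e2 : ratAdeleChar a = z := Sum.inr_injective (hz.symm.trans hz')
      have e3 : ratAdeleChar a = y * z := Sum.inr_injective (hz.symm.trans hyz)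
      refine ⟨fun _ => a, ?_, funext fun i => h0.symm⟩
      have hne : ratAdeleChar a ≠ 0 := fun h => hadd
        ⟨0, 0, hz.trans (congrArg _ h), hz.trans (congrArg _ h),
          hz.trans (congrArg _ (h.trans (add_zero 0).symm))⟩
      rw [← e1, ← e2] at e3
      exact mul_left_cancel₀ hne (e3.symm.trans (mul_one _).symm)

theorem not_decidableTheory_twoSorted : ¬ DecidableTheory twoSorted (RatAdele ⊕ ℂ) := by
  refine adeleInterp_twoSorted.arithInterp.not_decidableTheory
    (σ := fun k => BoundedFormula.rel (L := twoSorted) (l := 3) TwoSortedRel.addRing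
      ![.var (.inr (Fin.castSucc (Fin.last (k + 2)))), .var (.inr (Fin.castSucc 0)),
        .var (.inr (Fin.last (k + 3)))]) ?_ ?_
  · intro k a xs z h0 ha
    have : ∀ w : Fin (k + 4) → RatAdele ⊕ ℂ,
        (BoundedFormula.rel (L := twoSorted) (l := 3) TwoSortedRel.addRing
          ![.var (.inr (Fin.castSucc (Fin.last (k + 2)))), .var (.inr (Fin.castSucc 0)),
          .var (.inr (Fin.last (k + 3)))] : twoSorted.BoundedFormula Empty (k + 4)).Realize
            default w ↔ ∃ b c, w (Fin.castSucc (Fin.last (k + 2))) = .inl b ∧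
              w (Fin.castSucc 0) = .inl c ∧ w (Fin.last (k + 3)) = .inl (b + c) :=
      fun w => Iff.rfl
    refine (this _).trans ?_
    simp only [Fin.snoc_castSucc, Fin.snoc_last, h0, ha]
    constructor
    · rintro ⟨b, c, hb, hc, rfl⟩
      rw [← Sum.inl_injective hb, ← Sum.inl_injective hc]
      simp
    · rintro rfl
      exact ⟨_, _, rfl, rfl, by simp⟩
  · -- The relation symbol, which has the number `2`, the size of the context, and the arguments.
    have h : ∀ k, symbolCodes (L := twoSorted) (BoundedFormula.rel (L := twoSorted) (l := 3)
        TwoSortedRel.addRing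
          ![.var (.inr (Fin.castSucc (Fin.last (k + 2)))), .var (.inr (Fin.castSucc 0)),
          .var (.inr (Fin.last (k + 3)))] : twoSorted.BoundedFormula Empty (k + 4)) =
        [2 * (2 * 2) + 1, 2 * (2 * (k + 4) + 1) + 1,
          2 * Nat.pair (k + 4) (Nat.pair (2 * (2 * (k + 2) + 1)) 0 + 1),
          2 * Nat.pair (k + 4) (Nat.pair (2 * (2 * 0 + 1)) 0 + 1),
          2 * Nat.pair (k + 4) (Nat.pair (2 * (2 * (k + 3) + 1)) 0 + 1)] := fun k => rfl
    have hk : ∀ c, Primrec fun k : ℕ => k + c := fun c =>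
      Primrec.nat_add.comp Primrec.id (Primrec.const c)
    have hvar : ∀ c, Primrec fun k : ℕ =>
        2 * Nat.pair (k + 4) (Nat.pair (2 * (2 * (k + c) + 1)) 0 + 1) := fun c =>
      Primrec.nat_double.comp (Primrec₂.natPair.comp (hk 4) (Primrec.succ.comp
        (Primrec₂.natPair.comp (Primrec.nat_double.comp (Primrec.nat_double_succ.comp (hk c)))
          (Primrec.const 0))))
    refine Primrec.of_eq ?_ fun k => (h k).symm
    exact Primrec.list_cons.comp (Primrec.const _) <| Primrec.list_cons.comp
      (Primrec.nat_double_succ.comp (Primrec.nat_double_succ.comp (hk 4))) <|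
      Primrec.list_cons.comp (hvar 2) <| Primrec.list_cons.comp
      (Primrec.nat_double.comp (Primrec₂.natPair.comp (hk 4) (Primrec.const _))) <|
      Primrec.list_cons.comp (hvar 3) (Primrec.const [])

end

end AdelicCharacter

theorem mainTheorem12 :
    ¬ AdelicCharacter.DecidableTheory AdelicCharacter.twoSorted (AdelicCharacter.RatAdele ⊕ ℂ) ∧
      ¬ AdelicCharacter.DecidableTheory AdelicCharacter.ringWithPredicate AdelicCharacter.RatAdele :=
  ⟨AdelicCharacter.not_decidableTheory_twoSorted,
    AdelicCharacter.not_decidableTheory_ringWithPredicate⟩
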